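/- **Theorem (Accuracy vs robustness trade-off).** Let $A\in\mathbb{R}^{n\times n}$ with spectral radius $\rho(A)<1$, $C\in\mathbb{R}^{m\times n}$, $Q\ge 0$ (positive semidefinite), $R>0$ (positive definite) and $\Sigma_0\ge 0$. Consider the system $$x(t+1)=Ax(t)+w(t),\qquad y(t)=Cx(t)+v(t),\qquad t\ge 0,$$ where $x(0)\sim\mathcal N(0,\Sigma_0)$, $w(t)\sim\mathcal N(0,Q)$, $v(t)\sim\mathcal N(0,R)$ are all mutually independent. For a gain $K\in\mathbb{R}^{n\times m}$, let $\hat x(t+1)=A\hat x(t)+K[y(t+1)-CA\hat x(t)]$, started at an arbitrary deterministic $\hat x(0)$, and let $e(t)=x(t)-\hat x(t)$. Call $K$ admissible if $\rho(A-KCA)<1$; for such $K$ put $$P(K)=\lim_{t\to\infty}\mathbb{E}[e(t)e(t)^{\mathsf T}],\qquad \mathcal P(K)=\operatorname{tr}P(K),\qquad \mathcal S(K)=\operatorname{tr}\Big[\frac{d}{dR}\mathcal P(K)\Big],$$ where $\frac{d}{dR}\mathcal P(K)$ is the matrix of derivatives of $\mathcal P(K)$ with respect to the noise covariance $R$ (symmetric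 perturbations of $R$, $K$ held fixed). For real $\delta$ let $$\mathcal S^*(\delta)=\min\{\mathcal S(K): K \text{ admissible},\ \mathcal P(K)\le\delta\}.$$ Let $K_{\mathrm{kf}}$ denote the steady-state Kalman gain, that is, $K_{\mathrm{kf}}=XC^{\mathsf T}(CXC^{\mathsf T}+R)^{-1}$ where $X\ge 0$ solves the Riccati equation $X=AXA^{\mathsf T}-AXC^{\mathsf T}(CXC^{\mathsf T}+R)^{-1}CXA^{\mathsf T}+Q$. Then such a gain $K_{\mathrm{kf}}$ exists, and every such gain is admissible; for every $\delta\in[\mathcal P(K_{\mathrm{kf}}),\mathcal P(0)]$ the minimum defining $\mathcal S^*(\delta)$ is attained; and $\mathcal S^*$ is strictly decreasing on $[\mathcal P(K_{\mathrm{kf}}),\mathcal P(0)]$. -/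

import Mathlib

open Matrix MeasureTheory ProbabilityTheory Filter Topology

noncomputable section

/-- The data of the system `x(t+1) = A x(t) + w(t)`, `y(t) = C x(t) + v(t)`, with
`w(t) ∼ N(0, Q)`, `v(t) ∼ N(0, R)`, `x(0) ∼ N(0, Sigma0)`, together with the (deterministic)
initial estimate `xhat0` at which the filter is started. -/
structure FilterModel (n m : ℕ) where
  A : Matrix (Fin n) (Fin n) ℝ
  C : Matrix (Fin m) (Fin n) ℝ
  Q : Matrix (Fin n) (Fin n) ℝ
  R : Matrix (Fin m) (Fin m) ℝ
  Sigma0 : Matrix (Fin n) (Fin n) ℝ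
  xhat0 : Fin n → ℝ

/-- Stability of a real square matrix: its spectral radius (over `ℂ`) is less than `1`. -/
def IsStableMatrix {n : ℕ} (A : Matrix (Fin n) (Fin n) ℝ) : Prop :=
  spectralRadius ℂ (A.map (algebraMap ℝ ℂ)) < 1

/-- Realizations of the randomness: the initial state, the process noise, the measurement
noise. -/
abbrev NoiseSpace (n m : ℕ) : Type :=
  EuclideanSpace ℝ (Fin n) × (ℕ → EuclideanSpace ℝ (Fin n)) × (ℕ → EuclideanSpace ℝ (Fin m))

namespace FilterModel

variable {n m : ℕ}

/-- The joint law of `x(0)`, `(w(t))`, `(v(t))`: all of them Gaussian and mutually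
independent. -/
def noiseLaw (G : FilterModel n m) : Measure (NoiseSpace n m) :=
  (multivariateGaussian 0 G.Sigma0).prod
    ((Measure.infinitePi fun _ : ℕ => multivariateGaussian 0 G.Q).prod
      (Measure.infinitePi fun _ : ℕ => multivariateGaussian 0 G.R))

/-- The state `x(t)`. -/
def state (G : FilterModel n m) (ω : NoiseSpace n m) : ℕ → Fin n → ℝ
  | 0 => ω.1.ofLp
  | t + 1 => G.A *ᵥ G.state ω t + (ω.2.1 t).ofLp

/-- The output `y(t)`. -/
def output (G : FilterModel n m) (ω : NoiseSpace n m) (t : ℕ) : Fin m → ℝ :=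
  G.C *ᵥ G.state ω t + (ω.2.2 t).ofLp

/-- The estimate of the filter with constant gain `K`:
`x̂(t+1) = A x̂(t) + K (y(t+1) - C A x̂(t))`. -/
def estimate (G : FilterModel n m) (K : Matrix (Fin n) (Fin m) ℝ) (ω : NoiseSpace n m) :
    ℕ → Fin n → ℝ
  | 0 => G.xhat0
  | t + 1 => G.A *ᵥ G.estimate K ω t +
      K *ᵥ (G.output ω (t + 1) - G.C *ᵥ (G.A *ᵥ G.estimate K ω t))

/-- The estimation error `e(t) = x(t) - x̂(t)`. -/
def error (G : FilterModel n m) (K : Matrix (Fin n) (Fin m) ℝ) (ω : NoiseSpace n m) (t : ℕ) :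
    Fin n → ℝ :=
  G.state ω t - G.estimate K ω t

/-- The error covariance `P(t) = 𝔼[e(t) e(t)ᵀ]`. -/
def errorCov (G : FilterModel n m) (K : Matrix (Fin n) (Fin m) ℝ) (t : ℕ) :
    Matrix (Fin n) (Fin n) ℝ :=
  Matrix.of fun i j => ∫ ω, G.error K ω t i * G.error K ω t j ∂G.noiseLaw

/-- The steady-state error covariance `P(K) = lim_{t → ∞} P(t)`. -/
def steadyCov (G : FilterModel n m) (K : Matrix (Fin n) (Fin m) ℝ) : Matrix (Fin n) (Fin n) ℝ :=
  limUnder atTop fun t => G.errorCov K t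

/-- The error `𝒫(K) = tr P(K)`. -/
def perf (G : FilterModel n m) (K : Matrix (Fin n) (Fin m) ℝ) : ℝ :=
  (G.steadyCov K).trace

/-- The derivative `d𝒫(K)/dR` at the nominal `R`, as a matrix: its `(i, j)` entry is the
derivative of `𝒫(K)` in the direction of the symmetric matrix `(E_ij + E_ji) / 2`, so that
`d𝒫(K) = tr ((d𝒫(K)/dR)ᵀ dR)` for symmetric `dR`. -/
def dPerfdR (G : FilterModel n m) (K : Matrix (Fin n) (Fin m) ℝ) : Matrix (Fin m) (Fin m) ℝ :=
  Matrix.of fun i j => deriv (fun s : ℝ =>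
    perf { G with R := G.R + s • ((1 / 2 : ℝ) • (Matrix.single i j 1 + Matrix.single j i 1)) } K) 0

/-- The sensitivity `𝒮(K) = tr (d𝒫(K)/dR)`. -/
def sens (G : FilterModel n m) (K : Matrix (Fin n) (Fin m) ℝ) : ℝ :=
  (G.dPerfdR K).trace

/-- The gain `K` is admissible: `A_K = A - K C A` is stable. -/
def IsAdmissible (G : FilterModel n m) (K : Matrix (Fin n) (Fin m) ℝ) : Prop :=
  IsStableMatrix (G.A - K * G.C * G.A)

/-- The admissible gains with `𝒫(K) ≤ δ`. -/
def feasible (G : FilterModel n m) (δ : ℝ) : Set (Matrix (Fin n) (Fin m) ℝ) :=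
  {K | G.IsAdmissible K ∧ G.perf K ≤ δ}

/-- The optimal value `𝒮*(δ)` of: minimize `𝒮(K)` subject to `𝒫(K) ≤ δ`. -/
def optSens (G : FilterModel n m) (δ : ℝ) : ℝ :=
  sInf (G.sens '' G.feasible δ)

/-- `K` is the steady-state gain of the Kalman filter: `K = X Cᵀ (C X Cᵀ + R)⁻¹`, where the
one-step prediction error covariance `X ≥ 0` solves the filtering algebraic Riccati equation. -/
def IsKalmanGain (G : FilterModel n m) (K : Matrix (Fin n) (Fin m) ℝ) : Prop :=
  ∃ X : Matrix (Fin n) (Fin n) ℝ, X.PosSemidef ∧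
    X = G.A * X * G.Aᵀ
      - G.A * X * G.Cᵀ * (G.C * X * G.Cᵀ + G.R)⁻¹ * G.C * X * G.Aᵀ + G.Q ∧
    K = X * G.Cᵀ * (G.C * X * G.Cᵀ + G.R)⁻¹

end FilterModel

end

/-! For admissible K the error covariance obeys P(t+1) = F P(t) Fᵀ + V with F = (1 - KC)A stable and
V = (1 - KC)Q(1 - KC)ᵀ + KRKᵀ, so P(K) is the unique solution of a Lyapunov equation, linear in Q
and R. Differentiating in R therefore gives 𝒮(K) as the cost of the same filter with Q = 0 and R = 1
(`sens_eq_gainCost`), and both objectives can be studied through `gainCost`.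

Two facts carry the proof. First, completing the square in the gain shows that moving K towards the
best update gain L for its own prior covariance strictly lowers the cost unless K = L
(`gainCost_segment_lt`). For 𝒮, where Q = 0 and A is stable, K = L forces K = 0
(`eq_zero_of_eq_updateGain`), so no nonzero gain is a local minimum of 𝒮. Second, sublevel sets of
the cost are compact (`isCompact_gainCost_le`): R > 0 bounds K, and stability of A keeps limits
admissible.

Compactness gives attainment; minimizing 𝒫 itself yields a gain with K = L, which is a Kalman gain.
If δ₁ < δ₂ ≤ 𝒫(0), a minimizer for δ₁ is nonzero because 𝒫(0) > δ₁, and the slack in 𝒫 allows a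
small move that lowers 𝒮 and stays feasible for δ₂. -/

noncomputable section

/-! ### Spectral stability and a Lyapunov test for it -/

section Stability

open scoped ComplexOrder

variable {n m : ℕ}

/-- The complexification of a real positive semidefinite matrix is positive semidefinite. -/
theorem Matrix.PosSemidef.map_ofReal {ι : Type*} [Fintype ι] [DecidableEq ι]
    {P : Matrix ι ι ℝ} (hP : P.PosSemidef) : (P.map (algebraMap ℝ ℂ)).PosSemidef := by
  obtain ⟨B, rfl⟩ := by
    open scoped MatrixOrder in
    exact CStarAlgebra.nonneg_iff_eq_star_mul_self.mp hP.nonneg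
  have : (star B * B).map (algebraMap ℝ ℂ)
      = (B.map (algebraMap ℝ ℂ))ᴴ * B.map (algebraMap ℝ ℂ) := by
    rw [Matrix.map_mul]
    congr 1
    ext i j
    simp [Matrix.star_eq_conjTranspose]
  rw [this]
  exact posSemidef_conjTranspose_mul_self _

theorem Matrix.PosDef.map_ofReal {ι : Type*} [Fintype ι] [DecidableEq ι]
    {P : Matrix ι ι ℝ} (hP : P.PosDef) : (P.map (algebraMap ℝ ℂ)).PosDef := by
  rw [hP.posSemidef.map_ofReal.posDef_iff_isUnit]
  exact hP.isUnit.map (algebraMap ℝ ℂ).mapMatrix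

theorem isStableMatrix_iff {F : Matrix (Fin n) (Fin n) ℝ} :
    IsStableMatrix F ↔ ∀ z ∈ spectrum ℂ (F.map (algebraMap ℝ ℂ)), ‖z‖ < 1 := by
  open scoped Matrix.Norms.Operator in
  constructor
  · intro h z hz
    have : (‖z‖₊ : ENNReal) < 1 := lt_of_le_of_lt (le_iSup₂ (α := ENNReal) z hz) h
    exact_mod_cast this
  · intro h
    by_cases hne : (spectrum ℂ (F.map (algebraMap ℝ ℂ))).Nonempty
    · exact spectrum.spectralRadius_lt_of_forall_lt_of_nonempty hne (r := 1)
        fun z hz => by exact_mod_cast h z hz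
    · rw [Set.not_nonempty_iff_eq_empty] at hne
      rw [IsStableMatrix, spectralRadius, hne]
      simp

/-- Upper hemicontinuity of the spectrum: it stays inside the open unit disc under small
perturbations. -/
theorem isOpen_setOf_isStableMatrix :
    IsOpen {F : Matrix (Fin n) (Fin n) ℝ | IsStableMatrix F} := by
  have h : {F : Matrix (Fin n) (Fin n) ℝ | IsStableMatrix F} =
      (fun F : Matrix (Fin n) (Fin n) ℝ => F.map (algebraMap ℝ ℂ)) ⁻¹'
        {a | spectrum ℂ a ⊆ Metric.ball 0 1} := by
    ext F
    simp [isStableMatrix_iff, Set.subset_def]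
  rw [h]
  refine IsOpen.preimage (continuous_id.matrix_map (by fun_prop)) ?_
  open scoped Matrix.Norms.Operator in
  have := (upperHemicontinuous_spectrum ℂ (Matrix (Fin n) (Fin n) ℂ)).isOpen (Metric.ball 0 1)
  simp only [Metric.isOpen_ball.mem_nhdsSet] at this
  exact this

/-- Gelfand's formula over ℂ: for q strictly between the spectral radius and 1, the norm of the k-th
power is eventually below q ^ k. Real parts return the statement to ℝ. -/
theorem IsStableMatrix.tendsto_pow {F : Matrix (Fin n) (Fin n) ℝ} (hF : IsStableMatrix F) :
    Tendsto (fun k => F ^ k) atTop (𝓝 0) := by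
  have hc : Tendsto (fun k => (F.map (algebraMap ℝ ℂ)) ^ k) atTop (𝓝 0) := by
    open scoped Matrix.Norms.Operator in
    set a := F.map (algebraMap ℝ ℂ)
    obtain ⟨q, hq, hq1⟩ := ENNReal.lt_iff_exists_nnreal_btwn.mp hF
    have hev := (spectrum.pow_nnnorm_pow_one_div_tendsto_nhds_spectralRadius a).eventually
      (gt_mem_nhds hq)
    refine squeeze_zero_norm' ?_ (tendsto_pow_atTop_nhds_zero_of_lt_one q.coe_nonneg
      (by exact_mod_cast hq1))
    filter_upwards [hev, eventually_gt_atTop 0] with k hk hk0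
    have h1 := ENNReal.rpow_le_rpow hk.le (Nat.cast_nonneg (α := ℝ) k)
    rw [← ENNReal.rpow_mul, one_div, inv_mul_cancel₀ (by positivity), ENNReal.rpow_one,
      ENNReal.rpow_natCast] at h1
    exact_mod_cast h1
  have h2 := ((continuous_id.matrix_map Complex.continuous_re).tendsto
    (0 : Matrix (Fin n) (Fin n) ℂ)).comp hc
  convert h2 using 1
  · funext k
    have : (F.map (algebraMap ℝ ℂ)) ^ k = (F ^ k).map (algebraMap ℝ ℂ) :=
      (map_pow (algebraMap ℝ ℂ).mapMatrix F k).symm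
    rw [Function.comp_apply, this]
    ext i j
    simp
  · simp

theorem Matrix.mem_spectrum_iff_exists_transpose_mulVec {M : Matrix (Fin n) (Fin n) ℂ} {z : ℂ} :
    z ∈ spectrum ℂ M ↔ ∃ v ≠ 0, Mᵀ *ᵥ v = z • v := by
  rw [mem_spectrum_iff_isRoot_charpoly, ← charpoly_transpose, ← mem_spectrum_iff_isRoot_charpoly,
    ← spectrum_toLin', ← Module.End.hasEigenvalue_iff_mem_spectrum]
  constructor
  · intro h
    obtain ⟨v, hv⟩ := h.exists_hasEigenvector
    exact ⟨v, hv.2, by simpa using hv.apply_eq_smul⟩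
  · rintro ⟨v, hv0, hv⟩
    exact Module.End.hasEigenvalue_of_hasEigenvector (x := v)
      ⟨Module.End.mem_eigenspace_iff.mpr (by simpa using hv), hv0⟩

/-- If `P - F P Fᴴ - K R Kᴴ ≥ 0` with `P ≥ 0`, `R > 0`, then every left eigenvector of `F` for an
eigenvalue outside the open unit disc is annihilated by `K`. -/
theorem conjTranspose_mulVec_eq_zero_of_lyapunov {F P : Matrix (Fin n) (Fin n) ℂ}
    {K : Matrix (Fin n) (Fin m) ℂ} {R : Matrix (Fin m) (Fin m) ℂ} (hP : P.PosSemidef)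
    (hR : R.PosDef) (h : (P - F * P * Fᴴ - K * R * Kᴴ).PosSemidef) {z : ℂ} (hz : 1 ≤ ‖z‖)
    {v : Fin n → ℂ} (hv : Fᴴ *ᵥ v = z • v) : Kᴴ *ᵥ v = 0 := by
  by_contra hw
  have h1 := h.dotProduct_mulVec_nonneg v
  have h2 := hR.dotProduct_mulVec_pos hw
  have h3 := hP.dotProduct_mulVec_nonneg v
  have e1 : star v ⬝ᵥ (F * P * Fᴴ) *ᵥ v = (‖z‖ ^ 2 : ℝ) * (star v ⬝ᵥ P *ᵥ v) := by
    have : star v ⬝ᵥ (F * P * Fᴴ) *ᵥ v = star (Fᴴ *ᵥ v) ⬝ᵥ P *ᵥ (Fᴴ *ᵥ v) := by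
      rw [star_mulVec, conjTranspose_conjTranspose, ← dotProduct_mulVec, mulVec_mulVec,
        mulVec_mulVec, Matrix.mul_assoc]
    rw [this, hv, mulVec_smul, star_smul, smul_dotProduct, dotProduct_smul, smul_eq_mul,
      smul_eq_mul, ← mul_assoc]
    congr 1
    rw [mul_comm, Complex.star_def, Complex.mul_conj, Complex.normSq_eq_norm_sq]
  have e2 : star v ⬝ᵥ (K * R * Kᴴ) *ᵥ v = star (Kᴴ *ᵥ v) ⬝ᵥ R *ᵥ (Kᴴ *ᵥ v) := by
    rw [star_mulVec, conjTranspose_conjTranspose, ← dotProduct_mulVec, mulVec_mulVec,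
      mulVec_mulVec, Matrix.mul_assoc]
  rw [sub_mulVec, sub_mulVec, dotProduct_sub, dotProduct_sub, e1, e2] at h1
  rw [Complex.le_def] at h1 h3
  rw [Complex.lt_def] at h2
  obtain ⟨h1, -⟩ := h1
  obtain ⟨h2, -⟩ := h2
  obtain ⟨h3, -⟩ := h3
  simp only [Complex.sub_re, Complex.re_ofReal_mul, Complex.zero_re] at h1 h2 h3
  -- With w = Kᴴv the hypothesis reads (1 - |z|²) v*Pv - w*Rw ≥ 0, impossible when |z| ≥ 1 and w*Rw
  -- > 0.
  nlinarith [mul_nonneg (sub_nonneg.mpr (one_le_pow₀ hz (n := 2))) h3]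

/-- Detectability: if `A` is stable, a solution `P ≥ 0` of the Lyapunov inequality
`P ≥ F P Fᵀ + K R Kᵀ` for `F = A - K C A` forces `F` to be stable. -/
theorem isStableMatrix_of_lyapunov {A P : Matrix (Fin n) (Fin n) ℝ}
    {C : Matrix (Fin m) (Fin n) ℝ} {K : Matrix (Fin n) (Fin m) ℝ} {R : Matrix (Fin m) (Fin m) ℝ}
    (hA : IsStableMatrix A) (hP : P.PosSemidef) (hR : R.PosDef)
    (h : (P - (A - K * C * A) * P * (A - K * C * A)ᵀ - K * R * Kᵀ).PosSemidef) :
    IsStableMatrix (A - K * C * A) := by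
  rw [isStableMatrix_iff]
  intro z hz
  by_contra! hz1
  obtain ⟨v, hv0, hv⟩ := mem_spectrum_iff_exists_transpose_mulVec.mp hz
  have hH : ∀ {p q : ℕ} (M : Matrix (Fin p) (Fin q) ℝ),
      (M.map (algebraMap ℝ ℂ))ᴴ = (M.map (algebraMap ℝ ℂ))ᵀ := by
    intro p q M
    ext i j
    simp
  have hc := h.map_ofReal
  rw [Matrix.map_sub _ (map_sub _), Matrix.map_sub _ (map_sub _), Matrix.map_mul, Matrix.map_mul,
    Matrix.map_mul, Matrix.map_mul, transpose_map, transpose_map, ← hH, ← hH] at hc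
  have hK := conjTranspose_mulVec_eq_zero_of_lyapunov hP.map_ofReal hR.map_ofReal hc hz1
    (by rw [hH]; exact hv)
  -- Since Kᵀv = 0, the feedback term drops out and v is a left eigenvector of A for the same z,
  -- against stability of A.
  refine not_lt.mpr hz1 (isStableMatrix_iff.mp hA z
    (mem_spectrum_iff_exists_transpose_mulVec.mpr ⟨v, hv0, ?_⟩))
  rw [← hv, Matrix.map_sub _ (map_sub _), Matrix.map_mul, Matrix.map_mul, transpose_sub,
    transpose_mul, transpose_mul, sub_mulVec, ← mulVec_mulVec, ← mulVec_mulVec, ← hH K, hK]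
  simp

end Stability

/-! ### The discrete Lyapunov equation -/

section Lyapunov

open scoped Kronecker

variable {n m : ℕ}

theorem Matrix.PosSemidef.mul_mul_transpose_same {p q : ℕ} {P : Matrix (Fin p) (Fin p) ℝ}
    (hP : P.PosSemidef) (B : Matrix (Fin q) (Fin p) ℝ) : (B * P * Bᵀ).PosSemidef := by
  simpa using hP.mul_mul_conjTranspose_same B

theorem Matrix.PosSemidef.transpose_eq {p : ℕ} {P : Matrix (Fin p) (Fin p) ℝ}
    (hP : P.PosSemidef) : Pᵀ = P := by
  simpa [Matrix.IsHermitian] using hP.isHermitian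

theorem Matrix.isClosed_setOf_posSemidef {p : ℕ} :
    IsClosed {P : Matrix (Fin p) (Fin p) ℝ | P.PosSemidef} := by
  simp only [posSemidef_iff_dotProduct_mulVec, Set.ofPred_and, Set.ofPred_forall, Matrix.IsHermitian]
  refine IsClosed.inter (isClosed_eq (by fun_prop) continuous_id) (isClosed_iInter fun x => ?_)
  exact isClosed_le continuous_const
    (continuous_const.dotProduct (continuous_id.matrix_mulVec continuous_const))

/-- The solution `X` of the discrete Lyapunov equation `X = F X Fᵀ + V`, as a linear function
of `V`, written through the vectorized equation `(1 - F ⊗ F) vec X = vec V`. -/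
def lyap (F : Matrix (Fin n) (Fin n) ℝ) :
    Matrix (Fin n) (Fin n) ℝ →ₗ[ℝ] Matrix (Fin n) (Fin n) ℝ where
  toFun V := Matrix.of fun i j => ((1 - F ⊗ₖ F)⁻¹ *ᵥ vec V) (j, i)
  map_add' V W := by ext i j; simp [mulVec_add]
  map_smul' c V := by ext i j; simp [mulVec_smul]

theorem vec_lyap (F V : Matrix (Fin n) (Fin n) ℝ) :
    vec (lyap F V) = (1 - F ⊗ₖ F)⁻¹ *ᵥ vec V := rfl

theorem vec_sub_mul_mul_transpose (F X : Matrix (Fin n) (Fin n) ℝ) :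
    vec (X - F * X * Fᵀ) = (1 - F ⊗ₖ F) *ᵥ vec X := by
  rw [vec_sub, sub_mulVec, one_mulVec, kronecker_mulVec_vec]

namespace IsStableMatrix

variable {F : Matrix (Fin n) (Fin n) ℝ}

theorem tendsto_pow_mul_mul (hF : IsStableMatrix F) (X : Matrix (Fin n) (Fin n) ℝ) :
    Tendsto (fun k => F ^ k * X * (F ^ k)ᵀ) atTop (𝓝 0) := by
  have hc : Continuous fun Y : Matrix (Fin n) (Fin n) ℝ => Y * X * Yᵀ := by fun_prop
  have h := (hc.tendsto 0).comp hF.tendsto_pow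
  rw [transpose_zero, Matrix.mul_zero] at h
  exact h

/-- A kernel vector vec X satisfies X = F X Fᵀ, hence X = Fᵏ X (Fᵏ)ᵀ → 0. -/
theorem det_one_sub_kronecker_ne_zero (hF : IsStableMatrix F) : (1 - F ⊗ₖ F).det ≠ 0 := by
  intro h0
  obtain ⟨v, hv0, hv⟩ := exists_mulVec_eq_zero_iff.mpr h0
  obtain ⟨X, rfl⟩ := vec_bijective.surjective v
  rw [← vec_sub_mul_mul_transpose, vec_eq_zero_iff, sub_eq_zero] at hv
  have hk : ∀ k : ℕ, F ^ k * X * (F ^ k)ᵀ = X := by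
    intro k
    induction k with
    | zero => simp
    | succ k ih =>
      calc F ^ (k + 1) * X * (F ^ (k + 1))ᵀ = F ^ k * (F * X * Fᵀ) * (F ^ k)ᵀ := by
            rw [pow_succ, transpose_mul]; simp only [Matrix.mul_assoc]
        _ = X := by rw [← hv, ih]
  have := hF.tendsto_pow_mul_mul X
  simp only [hk] at this
  exact hv0 (vec_eq_zero_iff.mpr (tendsto_nhds_unique tendsto_const_nhds this))

theorem lyap_sub (hF : IsStableMatrix F) (X : Matrix (Fin n) (Fin n) ℝ) :
    lyap F (X - F * X * Fᵀ) = X := by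
  rw [← vec_inj, vec_lyap, vec_sub_mul_mul_transpose, mulVec_mulVec,
    nonsing_inv_mul _ (isUnit_iff_ne_zero.mpr hF.det_one_sub_kronecker_ne_zero), one_mulVec]

theorem lyap_unique (hF : IsStableMatrix F) {X V : Matrix (Fin n) (Fin n) ℝ}
    (h : X = F * X * Fᵀ + V) : X = lyap F V := by
  rw [← hF.lyap_sub X]
  congr 1
  rw [sub_eq_iff_eq_add']
  exact h

theorem lyap_eq (hF : IsStableMatrix F) (V : Matrix (Fin n) (Fin n) ℝ) :
    lyap F V = F * lyap F V * Fᵀ + V := by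
  rw [← sub_eq_iff_eq_add', ← vec_inj, vec_sub_mul_mul_transpose, vec_lyap, mulVec_mulVec,
    mul_nonsing_inv _ (isUnit_iff_ne_zero.mpr hF.det_one_sub_kronecker_ne_zero), one_mulVec]

theorem tendsto_lyap (hF : IsStableMatrix F) {V : Matrix (Fin n) (Fin n) ℝ}
    {P : ℕ → Matrix (Fin n) (Fin n) ℝ} (hP : ∀ t, P (t + 1) = F * P t * Fᵀ + V) :
    Tendsto P atTop (𝓝 (lyap F V)) := by
  have hk : ∀ t, P t = F ^ t * (P 0 - lyap F V) * (F ^ t)ᵀ + lyap F V := by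
    intro t
    induction t with
    | zero => simp
    | succ t ih =>
      rw [hP, pow_succ', transpose_mul]
      nth_rewrite 2 [hF.lyap_eq V]
      rw [← add_assoc]
      congr 1
      conv_lhs => rw [ih]
      simp only [Matrix.mul_add, Matrix.add_mul, Matrix.mul_assoc]
  have h := (hF.tendsto_pow_mul_mul (P 0 - lyap F V)).add_const (lyap F V)
  rw [zero_add] at h
  exact h.congr fun t => (hk t).symm

/-- The solution is the limit of the recursion started at 0, whose iterates lie in the closed
positive semidefinite cone. -/
theorem posSemidef_lyap (hF : IsStableMatrix F) {V : Matrix (Fin n) (Fin n) ℝ}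
    (hV : V.PosSemidef) : (lyap F V).PosSemidef := by
  let P : ℕ → Matrix (Fin n) (Fin n) ℝ := fun t => (fun X => F * X * Fᵀ + V)^[t] 0
  have hP : ∀ t, P (t + 1) = F * P t * Fᵀ + V := fun t => Function.iterate_succ_apply' _ _ _
  have hpos : ∀ t, (P t).PosSemidef := by
    intro t
    induction t with
    | zero => exact PosSemidef.zero
    | succ t ih => rw [hP]; exact (ih.mul_mul_transpose_same F).add hV
  exact isClosed_setOf_posSemidef.mem_of_tendsto (hF.tendsto_lyap hP) (.of_forall hpos)

theorem trace_le_trace_lyap (hF : IsStableMatrix F) {V : Matrix (Fin n) (Fin n) ℝ}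
    (hV : V.PosSemidef) : V.trace ≤ (lyap F V).trace := by
  conv_rhs => rw [hF.lyap_eq V, trace_add]
  have := ((hF.posSemidef_lyap hV).mul_mul_transpose_same F).trace_nonneg
  linarith

end IsStableMatrix

theorem continuousAt_lyap {X : Type*} [TopologicalSpace X]
    {F V : X → Matrix (Fin n) (Fin n) ℝ} {x : X} (hF : ContinuousAt F x) (hV : ContinuousAt V x)
    (hs : IsStableMatrix (F x)) : ContinuousAt (fun y => lyap (F y) (V y)) x := by
  have h1 : ContinuousAt (fun M : Matrix (Fin n) (Fin n) ℝ => (1 - M ⊗ₖ M)⁻¹) (F x) := by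
    have hc : Continuous fun M : Matrix (Fin n) (Fin n) ℝ => 1 - M ⊗ₖ M := by
      refine continuous_const.sub (continuous_matrix fun i j => ?_)
      exact (continuous_id.matrix_elem i.1 j.1).mul (continuous_id.matrix_elem i.2 j.2)
    refine ContinuousAt.comp (g := fun M => M⁻¹) (continuousAt_matrix_inv _ ?_) hc.continuousAt
    rw [Ring.inverse_eq_inv']
    exact continuousAt_inv₀ hs.det_one_sub_kronecker_ne_zero
  have h2 : ContinuousAt (fun y => ((1 - F y ⊗ₖ F y)⁻¹, V y)) x :=
    (ContinuousAt.comp h1 hF).prodMk hV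
  have h3 : Continuous fun p : Matrix (Fin n × Fin n) (Fin n × Fin n) ℝ ×
      Matrix (Fin n) (Fin n) ℝ => Matrix.of fun i j => (p.1 *ᵥ vec p.2) (j, i) := by
    refine continuous_matrix fun i j => ?_
    have hv : Continuous fun p : Matrix (Fin n × Fin n) (Fin n × Fin n) ℝ ×
        Matrix (Fin n) (Fin n) ℝ => vec p.2 :=
      continuous_pi fun k => continuous_snd.matrix_elem _ _
    exact (continuous_apply (j, i)).comp (continuous_fst.matrix_mulVec hv)
  exact h3.continuousAt.comp h2

end Lyapunov

/-! ### The cost of a gain and completion of squares -/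

namespace FilterModel

variable {n m : ℕ}

/-- The covariance injected by the process noise and the measurement noise in one step of the
error dynamics. -/
def gainNoise (G : FilterModel n m) (K : Matrix (Fin n) (Fin m) ℝ) : Matrix (Fin n) (Fin n) ℝ :=
  (1 - K * G.C) * G.Q * (1 - K * G.C)ᵀ + K * G.R * Kᵀ

/-- The steady-state error covariance as the solution of a Lyapunov equation. -/
def gainCov (G : FilterModel n m) (K : Matrix (Fin n) (Fin m) ℝ) : Matrix (Fin n) (Fin n) ℝ :=
  lyap (G.A - K * G.C * G.A) (G.gainNoise K)

/-- The trace of the solution of the Lyapunov equation. -/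
def gainCost (G : FilterModel n m) (K : Matrix (Fin n) (Fin m) ℝ) : ℝ :=
  (G.gainCov K).trace

/-- The covariance after a measurement update with gain `K` from the prior covariance `X`. -/
def measUpdate (G : FilterModel n m) (X : Matrix (Fin n) (Fin n) ℝ)
    (K : Matrix (Fin n) (Fin m) ℝ) : Matrix (Fin n) (Fin n) ℝ :=
  (1 - K * G.C) * X * (1 - K * G.C)ᵀ + K * G.R * Kᵀ

/-- The covariance of the innovation for the prior covariance `X`. -/
def innovCov (G : FilterModel n m) (X : Matrix (Fin n) (Fin n) ℝ) : Matrix (Fin m) (Fin m) ℝ :=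
  G.C * X * G.Cᵀ + G.R

/-- The gain minimizing the covariance after the measurement update. -/
def updateGain (G : FilterModel n m) (X : Matrix (Fin n) (Fin n) ℝ) :
    Matrix (Fin n) (Fin m) ℝ :=
  X * G.Cᵀ * (G.innovCov X)⁻¹

/-- The covariance after a time update from the covariance `P`. -/
def timeUpdate (G : FilterModel n m) (P : Matrix (Fin n) (Fin n) ℝ) : Matrix (Fin n) (Fin n) ℝ :=
  G.A * P * G.Aᵀ + G.Q

variable {G : FilterModel n m} {K : Matrix (Fin n) (Fin m) ℝ} {X P : Matrix (Fin n) (Fin n) ℝ}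

theorem posDef_innovCov (hR : G.R.PosDef) (hX : X.PosSemidef) : (G.innovCov X).PosDef :=
  PosDef.posSemidef_add (hX.mul_mul_transpose_same G.C) hR

theorem updateGain_mul_innovCov (hR : G.R.PosDef) (hX : X.PosSemidef) :
    G.updateGain X * G.innovCov X = X * G.Cᵀ :=
  nonsing_inv_mul_cancel_right _ _
    ((isUnit_iff_isUnit_det _).mp (posDef_innovCov hR hX).isUnit)

theorem innovCov_mul_updateGain_transpose (hR : G.R.PosDef) (hX : X.PosSemidef) :
    G.innovCov X * (G.updateGain X)ᵀ = G.C * X := by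
  have h := congrArg Matrix.transpose (updateGain_mul_innovCov hR hX)
  rwa [transpose_mul, transpose_mul, transpose_transpose, hX.transpose_eq,
    (posDef_innovCov hR hX).posSemidef.transpose_eq] at h

theorem measUpdate_eq_sub (hR : G.R.PosDef) (hX : X.PosSemidef) :
    G.measUpdate X (G.updateGain X)
      = X - G.updateGain X * G.innovCov X * (G.updateGain X)ᵀ := by
  have h1 := updateGain_mul_innovCov hR hX
  have h2 := innovCov_mul_updateGain_transpose hR hX
  set L := G.updateGain X
  have h3 : L * (G.C * X) = L * G.innovCov X * Lᵀ := by rw [← h2, Matrix.mul_assoc]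
  have h4 : X * G.Cᵀ * Lᵀ = L * G.innovCov X * Lᵀ := by rw [h1]
  have h5 : L * (G.C * X * G.Cᵀ) * Lᵀ + L * G.R * Lᵀ = L * G.innovCov X * Lᵀ := by
    rw [innovCov, Matrix.mul_add, Matrix.add_mul]
  calc G.measUpdate X L = X - L * (G.C * X) - X * G.Cᵀ * Lᵀ
        + (L * (G.C * X * G.Cᵀ) * Lᵀ + L * G.R * Lᵀ) := by
        simp only [measUpdate, transpose_sub, transpose_one, transpose_mul, Matrix.sub_mul,
          Matrix.mul_sub, Matrix.one_mul, Matrix.mul_one, Matrix.mul_assoc]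
        abel
    _ = _ := by rw [h3, h4, h5]; abel

/-- Completion of squares in the gain. -/
theorem measUpdate_eq_add (hR : G.R.PosDef) (hX : X.PosSemidef)
    (K : Matrix (Fin n) (Fin m) ℝ) :
    G.measUpdate X K = G.measUpdate X (G.updateGain X)
      + (K - G.updateGain X) * G.innovCov X * (K - G.updateGain X)ᵀ := by
  rw [measUpdate_eq_sub hR hX]
  have h1 := updateGain_mul_innovCov hR hX
  have h2 := innovCov_mul_updateGain_transpose hR hX
  set L := G.updateGain X
  have h3 : K * (G.C * X) = K * (G.innovCov X * Lᵀ) := by rw [← h2]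
  have h4 : X * G.Cᵀ * Kᵀ = L * G.innovCov X * Kᵀ := by rw [h1]
  have h5 : K * (G.C * X * G.Cᵀ) * Kᵀ + K * G.R * Kᵀ = K * G.innovCov X * Kᵀ := by
    rw [innovCov, Matrix.mul_add, Matrix.add_mul]
  calc G.measUpdate X K = X - K * (G.C * X) - X * G.Cᵀ * Kᵀ
        + (K * (G.C * X * G.Cᵀ) * Kᵀ + K * G.R * Kᵀ) := by
        simp only [measUpdate, transpose_sub, transpose_one, transpose_mul, Matrix.sub_mul,
          Matrix.mul_sub, Matrix.one_mul, Matrix.mul_one, Matrix.mul_assoc]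
        abel
    _ = _ := by
        rw [h3, h4, h5]
        simp only [transpose_sub, Matrix.sub_mul, Matrix.mul_sub, Matrix.mul_assoc]
        abel

/-- Fixed points of predict-then-update with gain `K` are thus exactly the solutions of the Lyapunov
equation for (1 - KC)A. -/
theorem measUpdate_timeUpdate (P : Matrix (Fin n) (Fin n) ℝ) (K : Matrix (Fin n) (Fin m) ℝ) :
    G.measUpdate (G.timeUpdate P) K
      = (G.A - K * G.C * G.A) * P * (G.A - K * G.C * G.A)ᵀ + G.gainNoise K := by
  have : G.A - K * G.C * G.A = (1 - K * G.C) * G.A := by rw [Matrix.sub_mul, Matrix.one_mul]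
  rw [this, measUpdate, timeUpdate, gainNoise, transpose_mul, Matrix.mul_add, Matrix.add_mul]
  simp only [Matrix.mul_assoc, add_assoc]

theorem posSemidef_gainNoise (hQ : G.Q.PosSemidef) (hR : G.R.PosSemidef)
    (K : Matrix (Fin n) (Fin m) ℝ) : (G.gainNoise K).PosSemidef :=
  (hQ.mul_mul_transpose_same _).add (hR.mul_mul_transpose_same _)

theorem posSemidef_gainCov (hQ : G.Q.PosSemidef) (hR : G.R.PosSemidef) (hK : G.IsAdmissible K) :
    (G.gainCov K).PosSemidef :=
  IsStableMatrix.posSemidef_lyap hK (posSemidef_gainNoise hQ hR K)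

theorem posSemidef_timeUpdate (hQ : G.Q.PosSemidef) (hP : P.PosSemidef) :
    (G.timeUpdate P).PosSemidef :=
  (hP.mul_mul_transpose_same _).add hQ

theorem gainCov_eq_measUpdate (hK : G.IsAdmissible K) :
    G.gainCov K = G.measUpdate (G.timeUpdate (G.gainCov K)) K := by
  rw [measUpdate_timeUpdate]
  exact IsStableMatrix.lyap_eq hK _

theorem gainCov_unique (hK : G.IsAdmissible K)
    (h : P = G.measUpdate (G.timeUpdate P) K) : P = G.gainCov K := by
  rw [measUpdate_timeUpdate] at h
  exact IsStableMatrix.lyap_unique hK h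

/-- A covariance that is reproduced by one step of the filter certifies admissibility. -/
theorem isAdmissible_of_eq_measUpdate (hA : IsStableMatrix G.A) (hQ : G.Q.PosSemidef)
    (hR : G.R.PosDef) (hP : P.PosSemidef) (h : P = G.measUpdate (G.timeUpdate P) K) :
    G.IsAdmissible K := by
  refine isStableMatrix_of_lyapunov hA hP hR ?_
  rw [measUpdate_timeUpdate, gainNoise] at h
  have : P - (G.A - K * G.C * G.A) * P * (G.A - K * G.C * G.A)ᵀ - K * G.R * Kᵀ
      = (1 - K * G.C) * G.Q * (1 - K * G.C)ᵀ := by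
    nth_rewrite 1 [h]
    abel
  rw [this]
  exact hQ.mul_mul_transpose_same _

theorem isOpen_setOf_isAdmissible : IsOpen {K | G.IsAdmissible K} :=
  isOpen_setOf_isStableMatrix.preimage
    (by fun_prop : Continuous fun K : Matrix (Fin n) (Fin m) ℝ => G.A - K * G.C * G.A)

theorem isAdmissible_zero (hA : IsStableMatrix G.A) : G.IsAdmissible 0 := by
  simpa [IsAdmissible] using hA

theorem continuousAt_gainCost (hK : G.IsAdmissible K) : ContinuousAt G.gainCost K := by
  have h : ContinuousAt G.gainCov K := by
    refine continuousAt_lyap ?_ ?_ hK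
    · exact Continuous.continuousAt (by fun_prop)
    · exact Continuous.continuousAt (by unfold gainNoise; fun_prop)
  exact (continuous_id.matrix_trace).continuousAt.comp h

/-- Moving the gain towards the optimal gain of the measurement update decreases the cost. -/
theorem gainCost_segment_lt (hQ : G.Q.PosSemidef) (hR : G.R.PosDef) (hK : G.IsAdmissible K)
    (hne : K ≠ G.updateGain (G.timeUpdate (G.gainCov K))) {t : ℝ} (ht : 0 < t) (ht1 : t < 1)
    (hKt : G.IsAdmissible (K + t • (G.updateGain (G.timeUpdate (G.gainCov K)) - K))) :
    G.gainCost (K + t • (G.updateGain (G.timeUpdate (G.gainCov K)) - K)) < G.gainCost K := by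
  have hP := posSemidef_gainCov hQ hR.posSemidef hK
  have hX := posSemidef_timeUpdate hQ hP
  have hN := posDef_innovCov hR hX
  have hPK := gainCov_eq_measUpdate hK
  set P := G.gainCov K with hPdef
  set X := G.timeUpdate P with hXdef
  set L := G.updateGain X with hL
  set D := (K - L) * G.innovCov X * (K - L)ᵀ with hD
  set K' := K + t • (L - K) with hK'
  have hDpos : D.PosSemidef := hN.posSemidef.mul_mul_transpose_same _
  -- If D = 0, positive definiteness of the innovation covariance kills every row of K - L.
  have hDtr : 0 < D.trace := by
    refine lt_of_le_of_ne hDpos.trace_nonneg fun h0 => hne ?_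
    have hD0 := hDpos.trace_eq_zero_iff.mp h0.symm
    ext i j
    by_contra hij
    have hv : (K - L)ᵀ *ᵥ Pi.single i 1 ≠ 0 := by
      intro hv
      have := congrFun hv j
      simp [sub_eq_zero] at this
      exact hij this
    have hpos := hN.dotProduct_mulVec_pos hv
    have : star ((K - L)ᵀ *ᵥ Pi.single i (1 : ℝ)) ⬝ᵥ
        G.innovCov X *ᵥ ((K - L)ᵀ *ᵥ Pi.single i (1 : ℝ)) =
        Pi.single i 1 ⬝ᵥ D *ᵥ Pi.single i 1 := by
      rw [star_trivial, hD, ← mulVec_mulVec, ← mulVec_mulVec, dotProduct_mulVec _ (K - L),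
        ← mulVec_transpose]
    rw [this, hD0] at hpos
    simp at hpos
  -- The prior X is held fixed: replacing K by K' shrinks the excess over the optimal update from D
  -- to (1 - t)² D.
  have hU : G.measUpdate X K' = P - (1 - (1 - t) ^ 2) • D := by
    rw [hPK, measUpdate_eq_add hR hX K', measUpdate_eq_add hR hX K]
    have : K' - L = (1 - t) • (K - L) := by
      rw [hK']; module
    rw [this, transpose_smul, Matrix.smul_mul, Matrix.smul_mul, Matrix.mul_smul]
    rw [← hD]
    module
  -- P overshoots the Lyapunov equation of K' by exactly (1 - (1 - t)²) D; inverting that equation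
  -- transfers the excess to the covariances.
  have hdiff : P - G.gainCov K' = (1 - (1 - t) ^ 2) • lyap (G.A - K' * G.C * G.A) D := by
    rw [← map_smul, ← hKt.lyap_sub P, gainCov, ← map_sub]
    congr 1
    rw [hXdef, measUpdate_timeUpdate] at hU
    rw [sub_sub, hU]
    abel
  have htr := congrArg Matrix.trace hdiff
  rw [trace_sub, trace_smul, smul_eq_mul] at htr
  have h1 := IsStableMatrix.trace_le_trace_lyap hKt hDpos
  have h2 : 0 < 1 - (1 - t) ^ 2 := by nlinarith
  have h3 : 0 < (1 - (1 - t) ^ 2) * (lyap (G.A - K' * G.C * G.A) D).trace :=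
    mul_pos h2 (hDtr.trans_le h1)
  rw [gainCost, gainCost]
  linarith

theorem exists_gainCost_lt (hQ : G.Q.PosSemidef) (hR : G.R.PosDef) (hK : G.IsAdmissible K)
    (hne : K ≠ G.updateGain (G.timeUpdate (G.gainCov K)))
    {s : Set (Matrix (Fin n) (Fin m) ℝ)} (hs : s ∈ 𝓝 K) :
    ∃ K' ∈ s, G.IsAdmissible K' ∧ G.gainCost K' < G.gainCost K := by
  set L := G.updateGain (G.timeUpdate (G.gainCov K))
  have hc : Tendsto (fun t : ℝ => K + t • (L - K)) (𝓝[>] 0) (𝓝 K) := by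
    have : Continuous fun t : ℝ => K + t • (L - K) := by fun_prop
    simpa using (this.tendsto 0).mono_left nhdsWithin_le_nhds
  have hadm : {K | G.IsAdmissible K} ∈ 𝓝 K := isOpen_setOf_isAdmissible.mem_nhds hK
  obtain ⟨t, ht, ⟨ht0, ht1⟩⟩ := ((hc.eventually (inter_mem hs hadm)).and
    (Ioo_mem_nhdsGT (zero_lt_one' ℝ))).exists
  exact ⟨_, ht.1, ht.2, gainCost_segment_lt hQ hR hK hne ht0 ht1 ht.2⟩

/-! ### Kalman gains, stationary gains and compactness -/

theorem isKalmanGain_iff : G.IsKalmanGain K ↔ ∃ X : Matrix (Fin n) (Fin n) ℝ, X.PosSemidef ∧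
    X = G.timeUpdate (X - X * G.Cᵀ * (G.innovCov X)⁻¹ * G.C * X) ∧ K = G.updateGain X := by
  refine exists_congr fun X => and_congr_right fun _ => and_congr_left fun _ => ?_
  have : G.timeUpdate (X - X * G.Cᵀ * (G.innovCov X)⁻¹ * G.C * X) = G.A * X * G.Aᵀ
      - G.A * X * G.Cᵀ * (G.C * X * G.Cᵀ + G.R)⁻¹ * G.C * X * G.Aᵀ + G.Q := by
    simp only [timeUpdate, innovCov, Matrix.mul_sub, Matrix.sub_mul, Matrix.mul_assoc]
  rw [this]

theorem measUpdate_updateGain (hR : G.R.PosDef) (hX : X.PosSemidef) :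
    G.measUpdate X (G.updateGain X) = X - X * G.Cᵀ * (G.innovCov X)⁻¹ * G.C * X := by
  rw [measUpdate_eq_sub hR hX, Matrix.mul_assoc, innovCov_mul_updateGain_transpose hR hX,
    updateGain]
  simp only [Matrix.mul_assoc]

/-- A stationary point of the cost is a Kalman gain. -/
theorem isKalmanGain_of_eq_updateGain (hQ : G.Q.PosSemidef) (hR : G.R.PosDef)
    (hK : G.IsAdmissible K) (h : K = G.updateGain (G.timeUpdate (G.gainCov K))) :
    G.IsKalmanGain K := by
  have hX := posSemidef_timeUpdate hQ (posSemidef_gainCov hQ hR.posSemidef hK)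
  refine isKalmanGain_iff.mpr ⟨_, hX, ?_, h⟩
  rw [← measUpdate_updateGain hR hX, ← h, ← gainCov_eq_measUpdate hK]

/-- The Riccati equation fixes the prior X under update-then-predict, so the updated covariance is
fixed under predict-then-update and certifies admissibility. -/
theorem IsKalmanGain.isAdmissible (hA : IsStableMatrix G.A) (hQ : G.Q.PosSemidef)
    (hR : G.R.PosDef) (h : G.IsKalmanGain K) : G.IsAdmissible K := by
  obtain ⟨X, hX, hric, rfl⟩ := isKalmanGain_iff.mp h
  rw [← measUpdate_updateGain hR hX] at hric
  refine isAdmissible_of_eq_measUpdate (P := G.measUpdate X (G.updateGain X)) hA hQ hR ?_ ?_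
  · exact (hX.mul_mul_transpose_same _).add (hR.posSemidef.mul_mul_transpose_same _)
  · rw [← hric]

/-- Without process noise, the only stationary gain of a stable system is zero. -/
theorem eq_zero_of_eq_updateGain (hA : IsStableMatrix G.A) (hQ : G.Q = 0) (hR : G.R.PosDef)
    (hK : G.IsAdmissible K) (h : K = G.updateGain (G.timeUpdate (G.gainCov K))) : K = 0 := by
  have hQ' : G.Q.PosSemidef := hQ ▸ PosSemidef.zero
  have hP := posSemidef_gainCov hQ' hR.posSemidef hK
  have hX := posSemidef_timeUpdate hQ' hP
  have hPK := gainCov_eq_measUpdate hK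
  set P := G.gainCov K
  have hXeq : G.timeUpdate P = G.A * P * G.Aᵀ := by rw [timeUpdate, hQ, add_zero]
  set X := G.timeUpdate P
  have hW := ((posDef_innovCov hR hX).posSemidef).mul_mul_transpose_same K
  rw [h, measUpdate_eq_sub hR hX, ← h] at hPK
  -- The optimal update gives P = APAᵀ - KNKᵀ with N the innovation covariance. Hence P is minus a
  -- positive semidefinite matrix, and P ≥ 0 leaves only P = 0.
  have hneg : P = -lyap G.A (K * G.innovCov X * Kᵀ) := by
    rw [← map_neg, ← hA.lyap_sub P, ← hXeq]
    congr 1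
    nth_rewrite 1 [hPK]
    abel
  have h1 := (hA.posSemidef_lyap hW).trace_nonneg
  have h2 := congrArg Matrix.trace hneg
  rw [trace_neg] at h2
  have hP0 : P = 0 := hP.trace_eq_zero_iff.mp (le_antisymm (by linarith) hP.trace_nonneg)
  rw [h, updateGain, hXeq, hP0]
  simp

/-- The admissible gains of bounded cost form a compact set. -/
theorem isCompact_gainCost_le (hA : IsStableMatrix G.A) (hQ : G.Q.PosSemidef) (hR : G.R.PosDef)
    (δ : ℝ) : IsCompact {K | G.IsAdmissible K ∧ G.gainCost K ≤ δ} := by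
  obtain ⟨B, hB⟩ : ∃ B : Matrix (Fin m) (Fin m) ℝ, G.R = Bᵀ * B := by
    open scoped MatrixOrder in
    obtain ⟨B, hB⟩ := CStarAlgebra.nonneg_iff_eq_star_mul_self.mp hR.posSemidef.nonneg
    exact ⟨B, by simpa [star_eq_conjTranspose] using hB⟩
  have hBu : IsUnit Bᵀ.det := by
    have := (isUnit_iff_isUnit_det _).mp hR.isUnit
    rw [hB, det_mul] at this
    exact isUnit_of_mul_isUnit_left this
  -- In the coordinate Z = KBᵀ, tr(KRKᵀ) is the sum of the squared entries of Z, and it is at most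
  -- tr P(K) ≤ δ. The box uses z² ≤ δ ≤ (1 + δ)².
  let gain : Matrix (Fin n) (Fin m) ℝ × Matrix (Fin n) (Fin n) ℝ → Matrix (Fin n) (Fin m) ℝ :=
    fun p => p.1 * (Bᵀ)⁻¹
  have hgain : Continuous gain := by fun_prop
  let box : Set (Matrix (Fin n) (Fin m) ℝ × Matrix (Fin n) (Fin n) ℝ) :=
    (Set.Icc (-(1 + δ)) (1 + δ)).matrix ×ˢ (Set.Icc (-δ) δ).matrix
  have hbox : IsCompact box := isCompact_Icc.matrix.prod isCompact_Icc.matrix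
  -- Admissibility is left out so that S is closed; the fixed-point equation with P ≥ 0 recovers it.
  let S : Set (Matrix (Fin n) (Fin m) ℝ × Matrix (Fin n) (Fin n) ℝ) :=
    {p | p.2.PosSemidef ∧ p.2 = G.measUpdate (G.timeUpdate p.2) (gain p) ∧ p.2.trace ≤ δ}
  have hS : IsClosed S := by
    refine (isClosed_setOf_posSemidef.preimage continuous_snd).inter
      (IsClosed.inter (isClosed_eq continuous_snd ?_)
        (isClosed_le continuous_snd.matrix_trace continuous_const))
    unfold measUpdate timeUpdate
    fun_prop
  convert (hbox.inter_right hS).image hgain using 1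
  ext K
  constructor
  · rintro ⟨hK, hδ⟩
    have hP := posSemidef_gainCov hQ hR.posSemidef hK
    have hKZ : K * Bᵀ * (Bᵀ)⁻¹ = K := mul_nonsing_inv_cancel_right _ _ hBu
    refine ⟨(K * Bᵀ, G.gainCov K), ⟨⟨?_, ?_⟩, hP, ?_, hδ⟩, hKZ⟩
    · have h1 : (K * Bᵀ * (K * Bᵀ)ᵀ).trace ≤ δ := by
        refine le_trans ?_ hδ
        have h2 := congrArg Matrix.trace (gainCov_eq_measUpdate hK)
        rw [measUpdate, trace_add] at h2
        have h3 := ((posSemidef_timeUpdate hQ hP).mul_mul_transpose_same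
          (1 - K * G.C)).trace_nonneg
        have h4 : K * Bᵀ * (K * Bᵀ)ᵀ = K * G.R * Kᵀ := by
          rw [hB, transpose_mul, transpose_transpose]
          simp only [Matrix.mul_assoc]
        rw [h4, gainCost]
        linarith
      intro i j
      have h5 : (K * Bᵀ) i j ^ 2 ≤ δ := by
        refine le_trans ?_ h1
        simp only [trace, diag_apply, mul_apply (N := (K * Bᵀ)ᵀ), transpose_apply (K * Bᵀ)]
        refine le_trans ?_ (Finset.single_le_sum
          (f := fun i => ∑ x, (K * Bᵀ) i x * (K * Bᵀ) i x)
          (fun i _ => Finset.sum_nonneg fun x _ => mul_self_nonneg _) (Finset.mem_univ i))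
        rw [sq]
        exact Finset.single_le_sum (f := fun x => (K * Bᵀ) i x * (K * Bᵀ) i x)
          (fun x _ => mul_self_nonneg _) (Finset.mem_univ j)
      have hδ0 : 0 ≤ δ := (sq_nonneg _).trans h5
      exact abs_le.mp (abs_le_of_sq_le_sq (by nlinarith) (by linarith))
    · intro i j
      have hle : ∀ i, G.gainCov K i i ≤ δ := fun i => le_trans
        (Finset.single_le_sum (f := fun i => G.gainCov K i i) (fun i _ => hP.diag_nonneg)
          (Finset.mem_univ i)) hδ
      have hsymm : G.gainCov K j i = G.gainCov K i j := congrFun (congrFun hP.transpose_eq i) j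
      -- Testing on eᵢ ± eⱼ bounds off-diagonal entries by diagonal ones.
      have hp := hP.dotProduct_mulVec_nonneg (Pi.single i 1 + Pi.single j 1)
      have hm := hP.dotProduct_mulVec_nonneg (Pi.single i 1 - Pi.single j 1)
      simp [mulVec_add, mulVec_sub, add_dotProduct, sub_dotProduct, hsymm] at hp hm
      have hi := hle i
      have hj := hle j
      constructor <;> linarith
    · simpa only [gain, hKZ] using gainCov_eq_measUpdate hK
  · rintro ⟨p, ⟨-, hP, heq, htr⟩, rfl⟩
    have hK := isAdmissible_of_eq_measUpdate hA hQ hR hP heq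
    exact ⟨hK, by rw [gainCost, ← gainCov_unique hK heq]; exact htr⟩

/-- A minimizer of the cost over the compact sublevel set of the gain 0 is stationary, since
otherwise a strictly better gain would lie in the same set. -/
theorem exists_isKalmanGain (hA : IsStableMatrix G.A) (hQ : G.Q.PosSemidef) (hR : G.R.PosDef) :
    ∃ K, G.IsKalmanGain K := by
  have h0 := isAdmissible_zero hA
  obtain ⟨K, ⟨hK, hK0⟩, hmin⟩ := (isCompact_gainCost_le hA hQ hR (G.gainCost 0)).exists_isMinOn
    ⟨0, h0, le_rfl⟩ fun K hK => (continuousAt_gainCost hK.1).continuousWithinAt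
  refine ⟨K, isKalmanGain_of_eq_updateGain hQ hR hK ?_⟩
  by_contra hne
  obtain ⟨K', -, hK', hlt⟩ := exists_gainCost_lt hQ hR hK hne univ_mem
  exact not_lt.mpr (hmin ⟨hK', hlt.le.trans hK0⟩) hlt

end FilterModel

/-! ### Mixed second moments of random vectors -/

section SecondMoment

variable {Ω : Type*} [MeasurableSpace Ω] {μ : Measure Ω} {p q r : ℕ}

/-- The matrix `𝔼[X Yᵀ]` of mixed second moments of two random vectors. -/
def secondMoment (μ : Measure Ω) (X : Ω → Fin p → ℝ) (Y : Ω → Fin q → ℝ) :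
    Matrix (Fin p) (Fin q) ℝ :=
  Matrix.of fun i j => ∫ ω, X ω i * Y ω j ∂μ

/-- A random vector all of whose coordinates are square integrable. -/
def IsSquareIntegrable (μ : Measure Ω) (X : Ω → Fin p → ℝ) : Prop :=
  ∀ i, MemLp (fun ω => X ω i) 2 μ

variable {X X' : Ω → Fin p → ℝ} {Y : Ω → Fin q → ℝ}

theorem IsSquareIntegrable.add (hX : IsSquareIntegrable μ X) (hX' : IsSquareIntegrable μ X') :
    IsSquareIntegrable μ fun ω => X ω + X' ω := fun i => (hX i).add (hX' i)

theorem IsSquareIntegrable.sub (hX : IsSquareIntegrable μ X) (hX' : IsSquareIntegrable μ X') :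
    IsSquareIntegrable μ fun ω => X ω - X' ω := fun i => (hX i).sub (hX' i)

theorem IsSquareIntegrable.mulVec (hY : IsSquareIntegrable μ Y)
    (M : Matrix (Fin p) (Fin q) ℝ) : IsSquareIntegrable μ fun ω => M *ᵥ Y ω := fun i => by
  simp only [Matrix.mulVec, dotProduct]
  exact memLp_finsetSum _ fun j _ => (hY j).const_mul _

theorem IsSquareIntegrable.integrable_mul (hX : IsSquareIntegrable μ X)
    (hY : IsSquareIntegrable μ Y) (i : Fin p) (j : Fin q) :
    Integrable (fun ω => X ω i * Y ω j) μ := (hX i).integrable_mul (hY j)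

theorem secondMoment_transpose (X : Ω → Fin p → ℝ) (Y : Ω → Fin q → ℝ) :
    (secondMoment μ X Y)ᵀ = secondMoment μ Y X := by
  ext i j
  simp [secondMoment, mul_comm]

theorem secondMoment_add_left (hX : IsSquareIntegrable μ X) (hX' : IsSquareIntegrable μ X')
    (hY : IsSquareIntegrable μ Y) :
    secondMoment μ (fun ω => X ω + X' ω) Y = secondMoment μ X Y + secondMoment μ X' Y := by
  ext i j
  simp only [secondMoment, of_apply, Pi.add_apply, Matrix.add_apply, add_mul]
  exact integral_add (hX.integrable_mul hY i j) (hX'.integrable_mul hY i j)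

theorem secondMoment_sub_left (hX : IsSquareIntegrable μ X) (hX' : IsSquareIntegrable μ X')
    (hY : IsSquareIntegrable μ Y) :
    secondMoment μ (fun ω => X ω - X' ω) Y = secondMoment μ X Y - secondMoment μ X' Y := by
  ext i j
  simp only [secondMoment, of_apply, Pi.sub_apply, Matrix.sub_apply, sub_mul]
  exact integral_sub (hX.integrable_mul hY i j) (hX'.integrable_mul hY i j)

theorem secondMoment_mulVec_left {Z : Ω → Fin r → ℝ} (hZ : IsSquareIntegrable μ Z)
    (hY : IsSquareIntegrable μ Y) (M : Matrix (Fin p) (Fin r) ℝ) :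
    secondMoment μ (fun ω => M *ᵥ Z ω) Y = M * secondMoment μ Z Y := by
  ext i j
  simp only [secondMoment, of_apply, Matrix.mulVec, dotProduct, mul_apply, Finset.sum_mul,
    mul_assoc]
  rw [integral_finsetSum _ fun k _ => (hZ.integrable_mul hY k j).const_mul _]
  simp only [integral_const_mul]

end SecondMoment

/-! ### Moments of Gaussian vectors and white noise -/

section Gaussian

variable {p : ℕ} {S : Matrix (Fin p) (Fin p) ℝ}

theorem memLp_eval_multivariateGaussian (i : Fin p) :
    MemLp (fun x : EuclideanSpace ℝ (Fin p) => x.ofLp i) 2 (multivariateGaussian 0 S) :=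
  (IsGaussian.memLp_two_id (μ := multivariateGaussian 0 S)).continuousLinearMap_comp
    (EuclideanSpace.proj (𝕜 := ℝ) i)

theorem integral_eval_multivariateGaussian (i : Fin p) :
    ∫ x, x.ofLp i ∂(multivariateGaussian 0 S) = 0 := by
  have h := ContinuousLinearMap.integral_comp_id_comm (μ := multivariateGaussian 0 S)
    (L := (EuclideanSpace.proj i : EuclideanSpace ℝ (Fin p) →L[ℝ] ℝ)) IsGaussian.integrable_id
  rw [integral_id_multivariateGaussian, map_zero] at h
  exact h

theorem integral_eval_mul_eval_multivariateGaussian (hS : S.PosSemidef) (i j : Fin p) :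
    ∫ x, x.ofLp i * x.ofLp j ∂(multivariateGaussian 0 S) = S i j := by
  have h := covariance_eq_sub (memLp_eval_multivariateGaussian (S := S) i)
    (memLp_eval_multivariateGaussian (S := S) j)
  rw [covariance_eval_multivariateGaussian hS, integral_eval_multivariateGaussian, zero_mul,
    sub_zero] at h
  exact h.symm

/-- The law of a sequence of independent Gaussian vectors with mean `0` and covariance `S`. -/
abbrev whiteNoise (S : Matrix (Fin p) (Fin p) ℝ) : Measure (ℕ → EuclideanSpace ℝ (Fin p)) :=
  Measure.infinitePi fun _ : ℕ => multivariateGaussian 0 S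

theorem integral_whiteNoise (t : ℕ) (i : Fin p) : ∫ ω, (ω t).ofLp i ∂(whiteNoise S) = 0 := by
  have hmp := measurePreserving_eval_infinitePi (fun _ : ℕ => multivariateGaussian 0 S) t
  have h := integral_map (μ := whiteNoise S) (φ := Function.eval t)
    hmp.measurable.aemeasurable
    (f := fun x : EuclideanSpace ℝ (Fin p) => x.ofLp i) (by fun_prop)
  rw [hmp.map_eq, integral_eval_multivariateGaussian] at h
  exact h.symm

theorem integral_whiteNoise_mul_of_ne {s t : ℕ} (h : s ≠ t) (i j : Fin p) :
    ∫ ω, (ω s).ofLp i * (ω t).ofLp j ∂(whiteNoise S) = 0 := by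
  have hm := integral_map (μ := whiteNoise S) (φ := fun ω => (ω s, ω t)) (by fun_prop)
    (f := fun z : EuclideanSpace ℝ (Fin p) × EuclideanSpace ℝ (Fin p) =>
      z.1.ofLp i * z.2.ofLp j) (by fun_prop)
  rw [Measure.infinitePi_map_eval_prod h] at hm
  rw [← hm]
  refine (integral_prod_mul (fun x : EuclideanSpace ℝ (Fin p) => x.ofLp i)
    fun x : EuclideanSpace ℝ (Fin p) => x.ofLp j).trans ?_
  rw [integral_eval_multivariateGaussian, zero_mul]

end Gaussian

/-! ### The error covariance recursion -/

namespace FilterModel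

variable {n m : ℕ} (G : FilterModel n m)

instance : IsProbabilityMeasure G.noiseLaw := by
  unfold noiseLaw
  infer_instance

/-- The process noise `w(t)`. -/
def processNoise (t : ℕ) (ω : NoiseSpace n m) : Fin n → ℝ := (ω.2.1 t).ofLp

/-- The measurement noise `v(t)`. -/
def measNoise (t : ℕ) (ω : NoiseSpace n m) : Fin m → ℝ := (ω.2.2 t).ofLp

theorem measurePreserving_initial :
    MeasurePreserving (fun ω : NoiseSpace n m => ω.1) G.noiseLaw
      (multivariateGaussian 0 G.Sigma0) :=
  measurePreserving_fst

theorem measurePreserving_processNoise (t : ℕ) :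
    MeasurePreserving (fun ω : NoiseSpace n m => ω.2.1 t) G.noiseLaw
      (multivariateGaussian 0 G.Q) :=
  (measurePreserving_eval_infinitePi (fun _ : ℕ => multivariateGaussian 0 G.Q) t).comp
    (measurePreserving_fst.comp measurePreserving_snd)

theorem measurePreserving_measNoise (t : ℕ) :
    MeasurePreserving (fun ω : NoiseSpace n m => ω.2.2 t) G.noiseLaw
      (multivariateGaussian 0 G.R) :=
  (measurePreserving_eval_infinitePi (fun _ : ℕ => multivariateGaussian 0 G.R) t).comp
    (measurePreserving_snd.comp measurePreserving_snd)

theorem isSquareIntegrable_initial :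
    IsSquareIntegrable G.noiseLaw fun ω => ω.1.ofLp := fun i =>
  (memLp_eval_multivariateGaussian i).comp_measurePreserving G.measurePreserving_initial

theorem isSquareIntegrable_processNoise (t : ℕ) :
    IsSquareIntegrable G.noiseLaw (processNoise t) := fun i =>
  (memLp_eval_multivariateGaussian i).comp_measurePreserving (G.measurePreserving_processNoise t)

theorem isSquareIntegrable_measNoise (t : ℕ) :
    IsSquareIntegrable G.noiseLaw (measNoise t) := fun i =>
  (memLp_eval_multivariateGaussian i).comp_measurePreserving (G.measurePreserving_measNoise t)

/-- An arbitrary `f` covers the shifted initial error x(0) - x̂(0). -/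
theorem secondMoment_initial_processNoise (f : EuclideanSpace ℝ (Fin n) → Fin n → ℝ) (t : ℕ) :
    secondMoment G.noiseLaw (fun ω => f ω.1) (processNoise t) = 0 := by
  ext i j
  refine (integral_prod_mul (μ := multivariateGaussian 0 G.Sigma0)
    (ν := (whiteNoise G.Q).prod (whiteNoise G.R)) (fun x => f x i)
    fun z => (z.1 t).ofLp j).trans ?_
  rw [integral_fun_fst fun z : ℕ → EuclideanSpace ℝ (Fin n) => (z t).ofLp j, integral_whiteNoise]
  simp

theorem secondMoment_initial_measNoise (f : EuclideanSpace ℝ (Fin n) → Fin n → ℝ) (t : ℕ) :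
    secondMoment G.noiseLaw (fun ω => f ω.1) (measNoise t) = 0 := by
  ext i j
  refine (integral_prod_mul (μ := multivariateGaussian 0 G.Sigma0)
    (ν := (whiteNoise G.Q).prod (whiteNoise G.R)) (fun x => f x i)
    fun z => (z.2 t).ofLp j).trans ?_
  rw [integral_fun_snd fun z : ℕ → EuclideanSpace ℝ (Fin m) => (z t).ofLp j, integral_whiteNoise]
  simp

theorem secondMoment_processNoise_measNoise (s t : ℕ) :
    secondMoment G.noiseLaw (processNoise s) (measNoise t) = 0 := by
  ext i j
  refine (integral_fun_snd (μ := multivariateGaussian 0 G.Sigma0)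
    (ν := (whiteNoise G.Q).prod (whiteNoise G.R))
    fun z => (z.1 s).ofLp i * (z.2 t).ofLp j).trans ?_
  rw [integral_prod_mul (fun z : ℕ → EuclideanSpace ℝ (Fin n) => (z s).ofLp i)
    fun z : ℕ → EuclideanSpace ℝ (Fin m) => (z t).ofLp j, integral_whiteNoise]
  simp

theorem secondMoment_processNoise_of_ne {s t : ℕ} (h : s ≠ t) :
    secondMoment G.noiseLaw (processNoise s) (processNoise t) = 0 := by
  ext i j
  refine (integral_fun_snd (μ := multivariateGaussian 0 G.Sigma0)
    (ν := (whiteNoise G.Q).prod (whiteNoise G.R))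
    fun z => (z.1 s).ofLp i * (z.1 t).ofLp j).trans ?_
  rw [integral_fun_fst fun z : ℕ → EuclideanSpace ℝ (Fin n) => (z s).ofLp i * (z t).ofLp j,
    integral_whiteNoise_mul_of_ne h]
  simp

theorem secondMoment_measNoise_of_ne {s t : ℕ} (h : s ≠ t) :
    secondMoment G.noiseLaw (measNoise s) (measNoise t) = 0 := by
  ext i j
  refine (integral_fun_snd (μ := multivariateGaussian 0 G.Sigma0)
    (ν := (whiteNoise G.Q).prod (whiteNoise G.R))
    fun z => (z.2 s).ofLp i * (z.2 t).ofLp j).trans ?_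
  rw [integral_fun_snd fun z : ℕ → EuclideanSpace ℝ (Fin m) => (z s).ofLp i * (z t).ofLp j,
    integral_whiteNoise_mul_of_ne h]
  simp

theorem secondMoment_processNoise_self (hQ : G.Q.PosSemidef) (t : ℕ) :
    secondMoment G.noiseLaw (processNoise t) (processNoise t) = G.Q := by
  ext i j
  have hmp := G.measurePreserving_processNoise t
  rw [← integral_eval_mul_eval_multivariateGaussian hQ i j, ← hmp.map_eq,
    integral_map hmp.measurable.aemeasurable (by fun_prop)]
  rfl

theorem secondMoment_measNoise_self (hR : G.R.PosSemidef) (t : ℕ) :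
    secondMoment G.noiseLaw (measNoise t) (measNoise t) = G.R := by
  ext i j
  have hmp := G.measurePreserving_measNoise t
  rw [← integral_eval_mul_eval_multivariateGaussian hR i j, ← hmp.map_eq,
    integral_map hmp.measurable.aemeasurable (by fun_prop)]
  rfl

variable (K : Matrix (Fin n) (Fin m) ℝ)

theorem error_succ (ω : NoiseSpace n m) (t : ℕ) :
    G.error K ω (t + 1) = (G.A - K * G.C * G.A) *ᵥ G.error K ω t
      + (1 - K * G.C) *ᵥ processNoise t ω - K *ᵥ measNoise (t + 1) ω := by
  simp only [error, estimate, output, state, processNoise, measNoise, mulVec_sub, mulVec_add,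
    sub_mulVec, one_mulVec, ← mulVec_mulVec]
  abel

theorem isSquareIntegrable_error (t : ℕ) :
    IsSquareIntegrable G.noiseLaw fun ω => G.error K ω t := by
  induction t with
  | zero => exact G.isSquareIntegrable_initial.sub fun i => memLp_const _
  | succ t ih =>
    simp only [error_succ]
    exact ((ih.mulVec _).add ((G.isSquareIntegrable_processNoise t).mulVec _)).sub
      ((G.isSquareIntegrable_measNoise (t + 1)).mulVec _)

/-- Leaving `Y` free lets one recursion serve both the noises and the error itself. -/
theorem secondMoment_error_succ {q : ℕ} {Y : NoiseSpace n m → Fin q → ℝ}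
    (hY : IsSquareIntegrable G.noiseLaw Y) (t : ℕ) :
    secondMoment G.noiseLaw (fun ω => G.error K ω (t + 1)) Y
      = (G.A - K * G.C * G.A) * secondMoment G.noiseLaw (fun ω => G.error K ω t) Y
        + (1 - K * G.C) * secondMoment G.noiseLaw (processNoise t) Y
        - K * secondMoment G.noiseLaw (measNoise (t + 1)) Y := by
  have he := G.isSquareIntegrable_error K t
  have hw := G.isSquareIntegrable_processNoise t
  have hv := G.isSquareIntegrable_measNoise (t + 1)
  simp only [error_succ]
  rw [secondMoment_sub_left ((he.mulVec _).add (hw.mulVec _)) (hv.mulVec _) hY,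
    secondMoment_add_left (he.mulVec _) (hw.mulVec _) hY, secondMoment_mulVec_left he hY,
    secondMoment_mulVec_left hw hY, secondMoment_mulVec_left hv hY]

/-- The error at time t involves only w(0), …, w(t - 1), so s = t is allowed here; it does involve
v(t), whence the strict inequality in `secondMoment_error_measNoise`. -/
theorem secondMoment_error_processNoise {s t : ℕ} (h : t ≤ s) :
    secondMoment G.noiseLaw (fun ω => G.error K ω t) (processNoise s) = 0 := by
  induction t with
  | zero => exact G.secondMoment_initial_processNoise (fun x => x.ofLp - G.xhat0) s
  | succ t ih =>
    rw [secondMoment_error_succ _ _ (G.isSquareIntegrable_processNoise s), ih (by omega),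
      secondMoment_processNoise_of_ne _ (by omega),
      ← secondMoment_transpose (processNoise s) (measNoise (t + 1)),
      secondMoment_processNoise_measNoise]
    simp

theorem secondMoment_error_measNoise {s t : ℕ} (h : t < s) :
    secondMoment G.noiseLaw (fun ω => G.error K ω t) (measNoise s) = 0 := by
  induction t with
  | zero => exact G.secondMoment_initial_measNoise (fun x => x.ofLp - G.xhat0) s
  | succ t ih =>
    rw [secondMoment_error_succ _ _ (G.isSquareIntegrable_measNoise s), ih (by omega),
      secondMoment_measNoise_of_ne _ (by omega), secondMoment_processNoise_measNoise]
    simp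

theorem errorCov_succ (hQ : G.Q.PosSemidef) (hR : G.R.PosSemidef) (t : ℕ) :
    G.errorCov K (t + 1)
      = (G.A - K * G.C * G.A) * G.errorCov K t * (G.A - K * G.C * G.A)ᵀ + G.gainNoise K := by
  have hcov : ∀ t, G.errorCov K t
      = secondMoment G.noiseLaw (fun ω => G.error K ω t) fun ω => G.error K ω t := fun _ => rfl
  have he := G.isSquareIntegrable_error K t
  have he' := G.isSquareIntegrable_error K (t + 1)
  have hw := G.isSquareIntegrable_processNoise t
  have hv := G.isSquareIntegrable_measNoise (t + 1)
  rw [hcov, hcov, secondMoment_error_succ _ _ he',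
    ← secondMoment_transpose (fun ω => G.error K ω (t + 1)) fun ω => G.error K ω t,
    ← secondMoment_transpose (fun ω => G.error K ω (t + 1)) (processNoise t),
    ← secondMoment_transpose (fun ω => G.error K ω (t + 1)) (measNoise (t + 1)),
    secondMoment_error_succ _ _ he, secondMoment_error_succ _ _ hw,
    secondMoment_error_succ _ _ hv, secondMoment_error_processNoise _ _ le_rfl,
    secondMoment_error_measNoise _ _ t.lt_succ_self,
    ← secondMoment_transpose (fun ω => G.error K ω t) (processNoise t),
    ← secondMoment_transpose (fun ω => G.error K ω t) (measNoise (t + 1)),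
    secondMoment_error_processNoise _ _ le_rfl, secondMoment_error_measNoise _ _ t.lt_succ_self,
    ← secondMoment_transpose (processNoise t) (measNoise (t + 1)),
    secondMoment_processNoise_measNoise, G.secondMoment_processNoise_self hQ,
    G.secondMoment_measNoise_self hR, gainNoise]
  have hsymm := secondMoment_transpose (μ := G.noiseLaw) (fun ω => G.error K ω t)
    fun ω => G.error K ω t
  simp only [transpose_zero, Matrix.mul_zero, add_zero, sub_zero, zero_add, zero_sub,
    transpose_mul, transpose_neg, hsymm, hQ.transpose_eq, hR.transpose_eq, Matrix.mul_neg,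
    sub_neg_eq_add, Matrix.mul_assoc, add_assoc]

variable {G K}

theorem steadyCov_eq_gainCov (hQ : G.Q.PosSemidef) (hR : G.R.PosSemidef)
    (hK : G.IsAdmissible K) : G.steadyCov K = G.gainCov K :=
  (IsStableMatrix.tendsto_lyap hK (G.errorCov_succ K hQ hR)).limUnder_eq

theorem perf_eq_gainCost (hQ : G.Q.PosSemidef) (hR : G.R.PosSemidef)
    (hK : G.IsAdmissible K) : G.perf K = G.gainCost K := by
  rw [perf, steadyCov_eq_gainCov hQ hR hK, gainCost]

end FilterModel

/-- A positive definite matrix stays positive semidefinite under small perturbations of one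
diagonal entry. -/
theorem Matrix.PosDef.eventually_posSemidef_add_single {m : ℕ} {R : Matrix (Fin m) (Fin m) ℝ}
    (hR : R.PosDef) (i : Fin m) :
    ∀ᶠ s : ℝ in 𝓝 0, (R + s • Matrix.single i i 1).PosSemidef := by
  set y : Fin m → ℝ := R⁻¹ *ᵥ Pi.single i 1
  have hy : R *ᵥ y = Pi.single i 1 := by
    rw [mulVec_mulVec, mul_nonsing_inv _ ((isUnit_iff_isUnit_det _).mp hR.isUnit), one_mulVec]
  set c : ℝ := y i with hc
  have hc0 : 0 ≤ c := by
    have := hR.posSemidef.dotProduct_mulVec_nonneg y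
    simpa [hy] using this
  -- Cauchy–Schwarz for the form of R, with c = (R⁻¹)ᵢᵢ, obtained by testing R on x - (xᵢ/(c + 1))
  -- y. It makes every s > -1/(c + 1) harmless.
  have hq : ∀ x : Fin m → ℝ, x i ^ 2 ≤ (c + 1) * (x ⬝ᵥ R *ᵥ x) := by
    intro x
    have h := hR.posSemidef.dotProduct_mulVec_nonneg (x - (x i / (c + 1)) • y)
    have hsymm : y ⬝ᵥ R *ᵥ x = x i := by
      rw [dotProduct_mulVec, ← mulVec_transpose, hR.posSemidef.transpose_eq, hy,
        single_one_dotProduct]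
    have hx : x i / (c + 1) * (c + 1) = x i := div_mul_cancel₀ _ (by positivity)
    simp only [star_trivial, mulVec_sub, mulVec_smul, dotProduct_sub, sub_dotProduct,
      smul_dotProduct, dotProduct_smul, hy, hsymm, dotProduct_single_one, smul_eq_mul,
      Pi.sub_apply, Pi.smul_apply] at h
    rw [← hc] at h
    set l := x i / (c + 1)
    rw [← hx] at h ⊢
    nlinarith [sq_nonneg l, mul_nonneg hc0 (sq_nonneg l)]
  have hev : ∀ᶠ s : ℝ in 𝓝 0, -1 < s * (c + 1) := by
    refine ContinuousAt.eventually_lt continuousAt_const (by fun_prop) (by simp)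
  filter_upwards [hev] with s hs
  refine PosSemidef.of_dotProduct_mulVec_nonneg ?_ fun x => ?_
  · refine hR.isHermitian.add ?_
    simp [Matrix.IsHermitian]
  · have hE : x ⬝ᵥ (s • Matrix.single i i (1 : ℝ)) *ᵥ x = s * x i ^ 2 := by
      rw [smul_mulVec, dotProduct_smul, single_mulVec, smul_eq_mul, one_mul]
      simp [← Pi.single.eq_1, sq]
    rw [star_trivial, add_mulVec, dotProduct_add, hE]
    have h0 := hR.posSemidef.dotProduct_mulVec_nonneg x
    rw [star_trivial] at h0
    rcases le_total 0 s with hs0 | hs0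
    · positivity
    · nlinarith [mul_le_mul_of_nonpos_left (hq x) hs0, mul_nonneg h0 (sub_nonneg.mpr hs.le)]

/-! ### The sensitivity as a cost, and the trade-off -/

namespace FilterModel

variable {n m : ℕ} {G : FilterModel n m} {K : Matrix (Fin n) (Fin m) ℝ}

/-- Near s = 0 the perturbed R is still a covariance, so 𝒫 is given by the Lyapunov solution and is
affine in s. The trace needs only these diagonal directions. -/
theorem dPerfdR_diag (hQ : G.Q.PosSemidef) (hR : G.R.PosDef) (hK : G.IsAdmissible K)
    (i : Fin m) : G.dPerfdR K i i
      = (lyap (G.A - K * G.C * G.A) (K * Matrix.single i i (1 : ℝ) * Kᵀ)).trace := by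
  set a := (lyap (G.A - K * G.C * G.A) (K * Matrix.single i i (1 : ℝ) * Kᵀ)).trace
  have hE : (1 / 2 : ℝ) • (Matrix.single i i 1 + Matrix.single i i 1)
      = (Matrix.single i i 1 : Matrix (Fin m) (Fin m) ℝ) := by module
  rw [dPerfdR, of_apply, hE]
  have hev : (fun s : ℝ => perf { G with R := G.R + s • Matrix.single i i 1 } K)
      =ᶠ[𝓝 0] fun s => G.gainCost K + s * a := by
    filter_upwards [hR.eventually_posSemidef_add_single i] with s hs
    rw [perf_eq_gainCost (G := { G with R := G.R + s • Matrix.single i i 1 }) hQ hs hK]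
    have hN : gainNoise { G with R := G.R + s • Matrix.single i i 1 } K
        = G.gainNoise K + s • (K * Matrix.single i i (1 : ℝ) * Kᵀ) := by
      simp only [gainNoise, Matrix.mul_add, Matrix.add_mul, Matrix.mul_smul, Matrix.smul_mul,
        add_assoc]
    rw [gainCost, gainCov, hN, gainCost, gainCov, map_add, map_smul, trace_add, trace_smul,
      smul_eq_mul]
  rw [hev.deriv_eq]
  simp

theorem sens_eq_gainCost (hQ : G.Q.PosSemidef) (hR : G.R.PosDef) (hK : G.IsAdmissible K) :
    G.sens K = gainCost { G with Q := 0, R := 1 } K := by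
  rw [sens, trace]
  simp only [diag_apply, dPerfdR_diag hQ hR hK]
  rw [← trace_sum, ← map_sum, ← Matrix.sum_mul, ← Matrix.mul_sum, sum_single_one, gainCost,
    gainCov, gainNoise]
  simp

theorem feasible_eq (hQ : G.Q.PosSemidef) (hR : G.R.PosDef) (δ : ℝ) :
    G.feasible δ = {K | G.IsAdmissible K ∧ G.gainCost K ≤ δ} := by
  ext K
  refine and_congr_right fun hK => ?_
  rw [perf_eq_gainCost hQ hR.posSemidef hK]

theorem isLeast_optSens (hA : IsStableMatrix G.A) (hQ : G.Q.PosSemidef) (hR : G.R.PosDef) {δ : ℝ}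
    (hne : (G.feasible δ).Nonempty) : IsLeast (G.sens '' G.feasible δ) (G.optSens δ) := by
  have hcomp : IsCompact (G.feasible δ) := by
    rw [feasible_eq hQ hR]
    exact isCompact_gainCost_le hA hQ hR δ
  have hcont : ContinuousOn G.sens (G.feasible δ) := by
    refine ContinuousOn.congr (f := gainCost { G with Q := 0, R := 1 }) (fun K hK => ?_)
      fun K hK => sens_eq_gainCost hQ hR hK.1
    exact (continuousAt_gainCost (G := { G with Q := 0, R := 1 }) hK.1).continuousWithinAt
  exact (hcomp.image_of_continuousOn hcont).isLeast_sInf (hne.image _)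

/-- The sensitivity has no local minimum among the nonzero admissible gains. -/
theorem exists_sens_lt (hA : IsStableMatrix G.A) (hQ : G.Q.PosSemidef) (hR : G.R.PosDef)
    (hK : G.IsAdmissible K) (hK0 : K ≠ 0) {s : Set (Matrix (Fin n) (Fin m) ℝ)} (hs : s ∈ 𝓝 K) :
    ∃ K' ∈ s, G.IsAdmissible K' ∧ G.sens K' < G.sens K := by
  obtain ⟨K', hK's, hK', hlt⟩ := exists_gainCost_lt (G := { G with Q := 0, R := 1 })
    PosSemidef.zero PosDef.one hK
    (fun h => hK0 (eq_zero_of_eq_updateGain (G := { G with Q := 0, R := 1 }) hA rfl PosDef.one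
      hK h)) hs
  refine ⟨K', hK's, hK', ?_⟩
  rwa [sens_eq_gainCost hQ hR hK, sens_eq_gainCost hQ hR hK']

/-- The left endpoint serves only to make the problem feasible, so any admissible gain may define
it. -/
theorem strictAntiOn_optSens (hA : IsStableMatrix G.A) (hQ : G.Q.PosSemidef) (hR : G.R.PosDef)
    (hK : G.IsAdmissible K) : StrictAntiOn G.optSens (Set.Icc (G.perf K) (G.perf 0)) := by
  intro δ₁ h₁ δ₂ h₂ hlt
  obtain ⟨⟨K₁, hK₁, hopt⟩, -⟩ := isLeast_optSens hA hQ hR ⟨K, hK, h₁.1⟩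
  have hne : K₁ ≠ 0 := by
    rintro rfl
    exact absurd (h₂.2.trans hK₁.2) (not_le.mpr hlt)
  -- The constraint δ₂ is slack at K₁, so by continuity a whole neighbourhood respects it.
  have hs : {K' | G.gainCost K' < δ₂} ∈ 𝓝 K₁ := by
    refine (continuousAt_gainCost hK₁.1).eventually_lt continuousAt_const ?_
    rw [← perf_eq_gainCost hQ hR.posSemidef hK₁.1]
    exact hK₁.2.trans_lt hlt
  obtain ⟨K₂, hK₂s, hK₂, hsens⟩ := exists_sens_lt hA hQ hR hK₁.1 hne hs
  refine lt_of_le_of_lt ((isLeast_optSens hA hQ hR ⟨K, hK, h₂.1⟩).2 ⟨K₂, ⟨hK₂, ?_⟩, rfl⟩)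
    (hsens.trans_eq hopt)
  rw [perf_eq_gainCost hQ hR.posSemidef hK₂]
  exact hK₂s.le

end FilterModel

end

theorem mainTheorem2 {n m : ℕ} (G : FilterModel n m)
    (hA : IsStableMatrix G.A) (hQ : G.Q.PosSemidef) (hR : G.R.PosDef)
    (hSigma0 : G.Sigma0.PosSemidef) :
    (∃ Kkf, G.IsKalmanGain Kkf) ∧
    ∀ Kkf, G.IsKalmanGain Kkf →
      G.IsAdmissible Kkf ∧
      (∀ δ ∈ Set.Icc (G.perf Kkf) (G.perf 0),
        IsLeast (G.sens '' G.feasible δ) (G.optSens δ)) ∧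
      StrictAntiOn G.optSens (Set.Icc (G.perf Kkf) (G.perf 0)) := by
  refine ⟨FilterModel.exists_isKalmanGain hA hQ hR, fun Kkf hkf => ?_⟩
  have hK := hkf.isAdmissible hA hQ hR
  exact ⟨hK, fun δ hδ => FilterModel.isLeast_optSens hA hQ hR ⟨Kkf, hK, hδ.1⟩,
    FilterModel.strictAntiOn_optSens hA hQ hR hK⟩
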